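/- A turn sequence is a finite word $\sigma=\sigma_1\cdots\sigma_n$ over $\{\mathtt L,\mathtt R\}$; write $\sigma_{l,r}$ if it has $l$ letters $\mathtt L$ and $r$ letters $\mathtt R$ (so $n=l+r$). A rectilinear chain $C$ realizes $\sigma$ if it is a simple (non-self-intersecting) polygonal chain of $n+1$ horizontal or vertical segments of positive integer length that starts at the origin $o$, whose first segment heads to the east, and whose $n$ bends are, in order from $o$, left turns ($\mathtt L$) and right turns ($\mathtt R$) by $90^\circ$ as prescribed by $\sigma$. Let $\sigma_{l,r}$ be a turn sequence with $l-r\ge 0$ and $l-r\not\equiv 0 \pmod 4$, and let $C$ be any rectilinear chain that realizes $\sigma_{l,r}$ and ends at a point $p=(a,0)$ with $a>0$. If $\sigma_1=\mathtt L$, then at least $$\left|\left\lfloor\frac{l-r}{4}\right\rfloor-1\right|+1$$ vertical segments of $C$ intersect the closed segment $\overline{op}$; if $\sigma_1=\mathtt R$, then at least $$\left\lfloor\frac{l-r}{4}\right\rfloor+1$$ vertical segments of $C$ intersect $\overline{op}$. -/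

import Mathlib

/-- A single turn: left (`L`) or right (`R`). -/
inductive Turn where
  | L
  | R
  deriving DecidableEq

/-- A point of the integer grid, seen as a point of the plane. -/
def toPlane (v : ℤ × ℤ) : ℝ × ℝ := ((v.1 : ℝ), (v.2 : ℝ))

/-- A simple rectilinear chain with `n` bends: `n + 2` vertices with integer coordinates, joined in
order by `n + 1` nondegenerate axis-parallel segments, without self-intersection. -/
structure RectChain (n : ℕ) where
  /-- The vertices of the chain; the first and the last one are its endpoints. -/
  vertex : Fin (n + 2) → ℤ × ℤ
  /-- Every segment has positive length. -/
  nondegenerate : ∀ i : Fin (n + 1), vertex i.castSucc ≠ vertex i.succ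
  /-- Every segment is horizontal or vertical. -/
  axisParallel : ∀ i : Fin (n + 1),
    (vertex i.castSucc).2 = (vertex i.succ).2 ∨ (vertex i.castSucc).1 = (vertex i.succ).1
  /-- Two different segments have no common point, except that two consecutive ones share the
  vertex where they are joined (and nothing else). -/
  simple : ∀ i j : Fin (n + 1), i < j → ∀ x : ℝ × ℝ,
    x ∈ segment ℝ (toPlane (vertex i.castSucc)) (toPlane (vertex i.succ)) →
    x ∈ segment ℝ (toPlane (vertex j.castSucc)) (toPlane (vertex j.succ)) →
    i.succ = j.castSucc ∧ x = toPlane (vertex j.castSucc)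

namespace RectChain

variable {n : ℕ}

/-- The `i`-th segment of the chain, as a set of points of the plane. -/
def seg (C : RectChain n) (i : Fin (n + 1)) : Set (ℝ × ℝ) :=
  segment ℝ (toPlane (C.vertex i.castSucc)) (toPlane (C.vertex i.succ))

/-- The direction vector of the `i`-th segment (directed from the start to the end of the chain). -/
def dir (C : RectChain n) (i : Fin (n + 1)) : ℤ × ℤ :=
  C.vertex i.succ - C.vertex i.castSucc

/-- The `i`-th segment is vertical. -/
def IsVertical (C : RectChain n) (i : Fin (n + 1)) : Prop :=
  (C.vertex i.castSucc).1 = (C.vertex i.succ).1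

/-- The point where the chain ends. -/
def endpoint (C : RectChain n) : ℤ × ℤ := C.vertex (Fin.last (n + 1))

end RectChain

/-- `IsTurn t d e`: passing from direction `d` to direction `e` is a turn of type `t`
(counterclockwise for `L`, clockwise for `R`), read off the sign of the cross product. For
axis-parallel directions a nonzero cross product means that `d` and `e` are perpendicular. -/
def IsTurn : Turn → ℤ × ℤ → ℤ × ℤ → Prop
  | Turn.L, d, e => 0 < d.1 * e.2 - d.2 * e.1
  | Turn.R, d, e => d.1 * e.2 - d.2 * e.1 < 0

/-- The chain `C` realizes the turn sequence `σ`: it starts at the origin, its first segment heads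
to the east, and its turns are those of `σ`, in order. -/
structure RectChain.Realizes {n : ℕ} (C : RectChain n) (σ : Fin n → Turn) : Prop where
  start : C.vertex 0 = (0, 0)
  east : 0 < (C.dir 0).1 ∧ (C.dir 0).2 = 0
  turns : ∀ i : Fin n, IsTurn (σ i) (C.dir i.castSucc) (C.dir i.succ)

/-- The number of occurrences of the turn `t` in the turn sequence `σ`. -/
def turnCount {n : ℕ} (σ : Fin n → Turn) (t : Turn) : ℕ :=
  (Finset.univ.filter fun i => σ i = t).card

/-- The set of (indices of) vertical segments of `C` that intersect the closed segment from the
origin to `p`. -/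
def RectChain.verticalMeeting {n : ℕ} (C : RectChain n) (p : ℤ × ℤ) : Set (Fin (n + 1)) :=
  {i | C.IsVertical i ∧ (C.seg i ∩ segment ℝ (toPlane (0, 0)) (toPlane p)).Nonempty}

/-! Cut the chain into unit steps and let the turning at a step be the number of left bends minus
right bends so far; at the last step it is `l - r`. Consider a visit to `(x, 0)` with `x > 0`, after
the first bend, and the last earlier visit `(y, 0)` with `0 ≤ y < x`. Unless a single step east
joins them, the path in between avoids the axis segment from `y` to `x`, and this segment, run
westward, completes it to a simple closed path of total turning `±4`. So an arc raises the turning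
by a bounded amount, and it leaves a vertical contact at `y`, to the left of `x`. Induction on time
(`turning_le`) yields turning at most `4 * V + c`, where `V` counts the vertical contacts in `[0,
x)` and `c` is `3` or `-1` according as the first bend is left or right. At the endpoint this is the
claim, except for a left first bend with `l - r < 4`, where two contacts are exhibited directly
(`exists_two_onVertical`).

The rotation number theorem (`sum_cross_closed`) is Hopf's argument made discrete. Chord directions
are measured in eighths of a turn; their changes cancel around unit squares in the triangle of index
pairs (`sectorChange_square`), so the change along the diagonal, twice the turning, equals the
change along the two legs. The latter is read off when the path starts at its lowest, leftmost
point. -/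

/-- The cross product of two integer vectors. -/
def cross (d e : ℤ × ℤ) : ℤ := d.1 * e.2 - d.2 * e.1

/-! ### Directions of grid vectors in eighths of a turn -/

/-- The four unit vectors of the grid. -/
def IsUnitStep (e : ℤ × ℤ) : Prop :=
  e = (1, 0) ∨ e = (0, 1) ∨ e = (-1, 0) ∨ e = (0, -1)

/-- The eight directions of a nonzero vector, counterclockwise from the east: the even numbers are
the half-axes, the odd numbers the open quadrants. -/
def sector (d : ℤ × ℤ) : ℤ :=
  if 0 < d.2 then (if 0 < d.1 then 1 else if d.1 = 0 then 2 else 3)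
  else if d.2 = 0 then (if 0 < d.1 then 0 else 4)
  else (if d.1 < 0 then 5 else if d.1 = 0 then 6 else 7)

/-- The change of sector from `d` to `e`, as the representative modulo `8` in `[-4, 4)`. -/
def sectorChange (d e : ℤ × ℤ) : ℤ := (sector e - sector d + 4) % 8 - 4

theorem IsUnitStep.neg {e : ℤ × ℤ} (he : IsUnitStep e) : IsUnitStep (-e) := by
  rcases he with rfl | rfl | rfl | rfl <;> simp [IsUnitStep]

/-- Only one coordinate changes, and by one, so its sign cannot skip zero; as the origin is
excluded, the sector moves at most to a neighbour. -/
theorem sectorChange_bounds {d e : ℤ × ℤ} (hd : d ≠ 0) (he : e ≠ 0) (h : IsUnitStep (e - d)) :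
    -1 ≤ sectorChange d e ∧ sectorChange d e ≤ 1 := by
  obtain ⟨x, y⟩ := d
  obtain ⟨x', y'⟩ := e
  simp only [IsUnitStep, Prod.mk_sub_mk, Prod.mk.injEq, ne_eq, Prod.mk_eq_zero] at h hd he
  simp only [sectorChange, sector]
  split_ifs <;> omega

/-- Both sides agree modulo 8, and each is at most 2 in absolute value. -/
theorem sectorChange_square {a b c d : ℤ × ℤ} (ha : a ≠ 0) (hb : b ≠ 0) (hc : c ≠ 0) (hd : d ≠ 0)
    (hab : IsUnitStep (b - a)) (hbc : IsUnitStep (c - b)) (had : IsUnitStep (d - a))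
    (hdc : IsUnitStep (c - d)) :
    sectorChange a b + sectorChange b c = sectorChange a d + sectorChange d c := by
  have h1 := sectorChange_bounds ha hb hab
  have h2 := sectorChange_bounds hb hc hbc
  have h3 := sectorChange_bounds ha hd had
  have h4 := sectorChange_bounds hd hc hdc
  simp only [sectorChange] at *
  omega

/-- A quarter turn is two sectors, with the diagonal `e + f` halfway. -/
theorem two_mul_cross {e f : ℤ × ℤ} (he : IsUnitStep e) (hf : IsUnitStep f) (h : e + f ≠ 0) :
    2 * cross e f = sectorChange e (e + f) + sectorChange (e + f) f := by
  rcases he with rfl | rfl | rfl | rfl <;> rcases hf with rfl | rfl | rfl | rfl <;>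
    first
    | exact absurd rfl h
    | decide

/-! ### The rotation number of a simple closed grid path -/

section Path

variable {u : ℕ → ℤ × ℤ}

/-- The squares between the chords ending at `u j` and those ending at `u (j + 1)` are glued along
their common sides. -/
theorem sum_sectorChange_strip {j a b : ℕ} (hab : a ≤ b)
    (hu : ∀ i, i ≤ b → IsUnitStep (u (i + 1) - u i)) (huj : IsUnitStep (u (j + 1) - u j))
    (hj : ∀ i, a ≤ i → i ≤ b → u i ≠ u j) (hj' : ∀ i, a ≤ i → i ≤ b → u i ≠ u (j + 1)) :
    ∑ i ∈ Finset.Ico a b, sectorChange (u j - u i) (u j - u (i + 1)) +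
        sectorChange (u j - u b) (u (j + 1) - u b) =
      sectorChange (u j - u a) (u (j + 1) - u a) +
        ∑ i ∈ Finset.Ico a b, sectorChange (u (j + 1) - u i) (u (j + 1) - u (i + 1)) := by
  induction b, hab using Nat.le_induction with
  | base => simp
  | succ b hab ih =>
    have ih := ih (fun i hi => hu i (by omega)) (fun i h1 h2 => hj i h1 (by omega))
      (fun i h1 h2 => hj' i h1 (by omega))
    rw [Finset.sum_Ico_succ_top hab, Finset.sum_Ico_succ_top hab]
    have hs : sectorChange (u j - u b) (u j - u (b + 1)) +
        sectorChange (u j - u (b + 1)) (u (j + 1) - u (b + 1)) =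
        sectorChange (u j - u b) (u (j + 1) - u b) +
        sectorChange (u (j + 1) - u b) (u (j + 1) - u (b + 1)) := by
      have hub := (hu b (by omega)).neg
      refine sectorChange_square (sub_ne_zero.2 (hj b hab (by omega)).symm)
        (sub_ne_zero.2 (hj (b + 1) (by omega) le_rfl).symm)
        (sub_ne_zero.2 (hj' (b + 1) (by omega) le_rfl).symm)
        (sub_ne_zero.2 (hj' b hab (by omega)).symm) ?_ ?_ ?_ ?_
      · convert hub using 1; abel
      · convert huj using 1; abel
      · convert huj using 1; abel
      · convert hub using 1; abel
    linarith

theorem two_mul_cross_path {j : ℕ} (h : u j ≠ u (j + 2)) (h1 : IsUnitStep (u (j + 1) - u j))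
    (h2 : IsUnitStep (u (j + 2) - u (j + 1))) :
    2 * cross (u (j + 1) - u j) (u (j + 2) - u (j + 1)) =
      sectorChange (u (j + 1) - u j) (u (j + 2) - u j) +
        sectorChange (u (j + 2) - u j) (u (j + 2) - u (j + 1)) := by
  have hs : u (j + 1) - u j + (u (j + 2) - u (j + 1)) = u (j + 2) - u j := by abel
  have := two_mul_cross h1 h2 (by rw [hs]; exact sub_ne_zero.2 h.symm)
  rwa [hs] at this

/-- Twice the total turning of a simple path is the change of direction of the chords from its start
plus the change of direction of the chords to its end. -/
theorem two_mul_sum_cross_open (j : ℕ) (hu : ∀ i, i ≤ j → IsUnitStep (u (i + 1) - u i))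
    (hinj : ∀ i k, i < k → k ≤ j + 1 → u i ≠ u k) :
    2 * ∑ i ∈ Finset.range j, cross (u (i + 1) - u i) (u (i + 2) - u (i + 1)) =
      ∑ i ∈ Finset.range j, sectorChange (u (i + 1) - u 0) (u (i + 2) - u 0) +
        ∑ i ∈ Finset.Ico 0 j, sectorChange (u (j + 1) - u i) (u (j + 1) - u (i + 1)) := by
  induction j with
  | zero => simp
  | succ j ih =>
    have ih := ih (fun i hi => hu i (by omega)) (fun i k h1 h2 => hinj i k h1 (by omega))
    -- The triangle of chords grows by one strip of squares and, at the diagonal, one triangle.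
    have hs := sum_sectorChange_strip (u := u) (j := j + 1) (Nat.zero_le j)
      (fun i hi => hu i (by omega)) (hu (j + 1) le_rfl)
      (fun i _ hi => hinj i _ (by omega) (by omega)) (fun i _ hi => hinj i _ (by omega) (by omega))
    have ht := two_mul_cross_path (hinj j (j + 2) (by omega) (by omega)) (hu j (by omega))
      (hu (j + 1) le_rfl)
    rw [Finset.sum_range_succ, Finset.sum_range_succ, Finset.sum_Ico_succ_top (Nat.zero_le j)]
    have e : j + 1 + 1 = j + 2 := rfl
    rw [e] at *
    linarith

/-- Within a window of four consecutive sectors no reduction modulo 8 takes place, so the sum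
telescopes. -/
theorem sum_sectorChange_of_bounded (f : ℕ → ℤ × ℤ) (c : ℤ) {a b : ℕ} (hab : a ≤ b)
    (hf : ∀ i, a ≤ i → i ≤ b → c ≤ sector (f i) ∧ sector (f i) ≤ c + 3) :
    ∑ i ∈ Finset.Ico a b, sectorChange (f i) (f (i + 1)) = sector (f b) - sector (f a) := by
  induction b, hab using Nat.le_induction with
  | base => simp
  | succ b hab ih =>
    rw [Finset.sum_Ico_succ_top hab, ih (fun i h1 h2 => hf i h1 (by omega))]
    have h1 := hf b hab (by omega)
    have h2 := hf (b + 1) (by omega) le_rfl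
    simp only [sectorChange]
    omega

/-- The lexicographic order "lower, then further to the left", as strict positivity. -/
def IsUpper (d : ℤ × ℤ) : Prop := 0 < d.2 ∨ (d.2 = 0 ∧ 0 < d.1)

theorem IsUpper.sector_bounds {d : ℤ × ℤ} (h : IsUpper d) : 0 ≤ sector d ∧ sector d ≤ 0 + 3 := by
  simp only [IsUpper, sector] at *
  split_ifs <;> omega

theorem IsUpper.sector_neg_bounds {d : ℤ × ℤ} (h : IsUpper d) :
    4 ≤ sector (-d) ∧ sector (-d) ≤ 4 + 3 := by
  simp only [IsUpper, sector, Prod.fst_neg, Prod.snd_neg] at *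
  split_ifs <;> omega

/-- Chords from the lowest point stay in sectors 0 to 3 and chords to it in sectors 4 to 7, so both
legs of the triangle depend only on their ends. -/
theorem sum_cross_closed_of_isUpper (j : ℕ) (hj : 1 ≤ j)
    (hu : ∀ i, i ≤ j + 1 → IsUnitStep (u (i + 1) - u i))
    (hinj : ∀ i k, i < k → k ≤ j + 1 → u i ≠ u k) (hcl : u (j + 2) = u 0)
    (hup : ∀ i, 1 ≤ i → i ≤ j + 1 → IsUpper (u i - u 0)) :
    ∑ i ∈ Finset.range (j + 1), cross (u (i + 1) - u i) (u (i + 2) - u (i + 1)) +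
        cross (u (j + 2) - u (j + 1)) (u 1 - u 0) = 4 ∨
    ∑ i ∈ Finset.range (j + 1), cross (u (i + 1) - u i) (u (i + 2) - u (i + 1)) +
        cross (u (j + 2) - u (j + 1)) (u 1 - u 0) = -4 := by
  have ho := two_mul_sum_cross_open j (fun i hi => hu i (by omega)) hinj
  have hne : ∀ i, 1 ≤ i → i ≤ j + 1 → u i ≠ u (j + 2) := fun i h1 h2 => by
    rw [hcl]; exact (hinj 0 i (by omega) h2).symm
  -- The last strip starts at index 1, because the chord from `u 0` to `u (j + 2)` vanishes.
  have hs := sum_sectorChange_strip (u := u) (j := j + 1) hj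
      (fun i hi => hu i (by omega)) (hu (j + 1) le_rfl)
      (fun i _ hi => hinj i _ (by omega) (by omega)) (fun i h1 hi => hne i h1 (by omega))
  have ht := two_mul_cross_path (hne j hj (by omega)) (hu j (by omega)) (hu (j + 1) le_rfl)
  have hrow := sum_sectorChange_of_bounded (fun i => u (i + 1) - u 0) 0 (Nat.zero_le j)
    (fun i _ hi => (hup (i + 1) (by omega) (by omega)).sector_bounds)
  have hcol := sum_sectorChange_of_bounded (fun i => u (j + 2) - u i) 4
    (show 1 ≤ j + 1 by omega) (fun i h1 hi => by
      have := (hup i h1 hi).sector_neg_bounds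
      rwa [hcl, ← neg_sub])
  rw [Finset.sum_Ico_succ_top hj] at hcol
  rw [← Finset.range_eq_Ico] at hrow
  rw [Finset.sum_eq_sum_Ico_succ_bot (show 0 < j by omega)] at ho
  rw [Finset.sum_range_succ]
  have e : j + 1 + 1 = j + 2 := rfl
  simp only [e, zero_add] at hs ht hrow hcol ho
  have key : 2 * (∑ i ∈ Finset.range j, cross (u (i + 1) - u i) (u (i + 2) - u (i + 1)) +
      cross (u (j + 1) - u j) (u (j + 2) - u (j + 1))) =
      sector (u (j + 1) - u 0) - sector (u 1 - u 0) +
      (sectorChange (u (j + 1) - u 0) (u (j + 1) - u 1) +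
        sectorChange (u (j + 1) - u 1) (u (j + 2) - u 1)) +
      (sector (u (j + 2) - u (j + 1)) - sector (u (j + 2) - u 1)) := by
    have e2 : ∀ i, i + 1 + 1 = i + 2 := fun _ => rfl
    simp only [e2] at *
    linarith
  generalize ∑ i ∈ Finset.range j, cross (u (i + 1) - u i) (u (i + 2) - u (i + 1)) +
      cross (u (j + 1) - u j) (u (j + 2) - u (j + 1)) = S at key ⊢
  have hg := (hu (j + 1) le_rfl).neg
  have hh := hu 0 (by omega)
  have hgu := hup (j + 1) (by omega) le_rfl
  have hhu := hup 1 le_rfl (by omega)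
  have hgh := hinj 1 (j + 1) (by omega) le_rfl
  simp only [e, zero_add] at hg hh
  rw [hcl] at key hg ⊢
  obtain ⟨g, hgd⟩ : ∃ g, u (j + 1) = u 0 + g := ⟨u (j + 1) - u 0, by abel⟩
  obtain ⟨h, hhd⟩ : ∃ h, u 1 = u 0 + h := ⟨u 1 - u 0, by abel⟩
  rw [hgd, hhd] at key
  rw [hgd] at hg hgu hgh
  rw [hhd] at hh hhu hgh
  rw [hgd, hhd]
  have r2 : u 0 + h - u 0 = h := by abel
  have r3 : u 0 + g - u 0 = g := by abel
  have r4 : u 0 + g - (u 0 + h) = g - h := by abel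
  have r5 : u 0 - (u 0 + h) = -h := by abel
  have r6 : u 0 - (u 0 + g) = -g := by abel
  simp only [r2, r3, r4, r5, r6, neg_neg] at key hg hgu hgh hh hhu ⊢
  -- Both neighbours of the lowest point lie east or north of it, and they differ: two cases
  -- survive, one for each orientation.
  rcases hg with rfl | rfl | rfl | rfl <;> rcases hh with rfl | rfl | rfl | rfl <;>
    simp [IsUpper, sector, sectorChange, cross] at key hgu hhu hgh ⊢ <;> omega

theorem sum_range_add_of_periodic {f : ℕ → ℤ} {M : ℕ} (hf : ∀ i, f (i + M) = f i) (a : ℕ) :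
    ∑ i ∈ Finset.range M, f (i + a) = ∑ i ∈ Finset.range M, f i := by
  induction a with
  | zero => rfl
  | succ a ih =>
    have h1 := Finset.sum_range_succ (fun i => f (i + a)) M
    have h2 := Finset.sum_range_succ' (fun i => f (i + a)) M
    have h3 : f (M + a) = f (0 + a) := by rw [add_comm, hf, zero_add]
    have h4 : ∀ i, f (i + (a + 1)) = f (i + 1 + a) := fun i => by congr 1; omega
    simp only [h4]
    linarith

theorem exists_lower_point (u : ℕ → ℤ × ℤ) (M : ℕ) (hM : 0 < M) :
    ∃ k < M, ∀ i < M, u i ≠ u k → IsUpper (u i - u k) := by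
  obtain ⟨k, hk, hmin⟩ := Finset.exists_min_image (Finset.range M)
    (fun i => toLex ((u i).2, (u i).1)) ⟨0, by simpa using hM⟩
  refine ⟨k, by simpa using hk, fun i hi hne => ?_⟩
  have := hmin i (by simpa using hi)
  rw [Prod.Lex.toLex_le_toLex] at this
  have hne' : ¬ ((u i).1 = (u k).1 ∧ (u i).2 = (u k).2) := fun h => hne (Prod.ext h.1 h.2)
  simp only [IsUpper, Prod.fst_sub, Prod.snd_sub] at this ⊢
  omega

/-- The total turning does not depend on where the period begins, so it may begin at the lowest,
leftmost point. -/
theorem sum_cross_periodic {M : ℕ} (hM : 3 ≤ M) (hper : ∀ i, u (i + M) = u i)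
    (hu : ∀ i, IsUnitStep (u (i + 1) - u i)) (hinj : ∀ i k, i < M → k < M → u i = u k → i = k) :
    ∑ i ∈ Finset.range M, cross (u (i + 1) - u i) (u (i + 2) - u (i + 1)) = 4 ∨
    ∑ i ∈ Finset.range M, cross (u (i + 1) - u i) (u (i + 2) - u (i + 1)) = -4 := by
  obtain ⟨k, hk, hmin⟩ := exists_lower_point u M (by omega)
  have hmod : ∀ i, u i = u (i % M) := fun i => by
    have : Function.Periodic u M := hper
    exact (this.map_mod_nat i).symm
  have hinj' : ∀ i l, i < l → l < M → u (i + k) ≠ u (l + k) := fun i l h1 h2 h => by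
    rw [hmod, hmod (l + k)] at h
    have := hinj _ _ (Nat.mod_lt _ (by omega)) (Nat.mod_lt _ (by omega)) h
    have := Nat.ModEq.add_right_cancel' k this
    rw [Nat.ModEq, Nat.mod_eq_of_lt h2, Nat.mod_eq_of_lt (by omega)] at this
    omega
  obtain ⟨j, rfl⟩ : ∃ j, M = j + 2 := ⟨M - 2, by omega⟩
  have e : ∀ i a, i + k + a = i + a + k := fun i a => by omega
  have := sum_cross_closed_of_isUpper (u := fun i => u (i + k)) j (by omega)
    (fun i _ => by rw [← e]; exact hu _)
    (fun i l h1 h2 => hinj' i l h1 (by omega))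
    (by rw [zero_add, add_comm, hper])
    (fun i h1 h2 => by
      have hne := (hinj' 0 i (by omega) (by omega)).symm
      rw [zero_add] at hne
      change IsUpper (u (i + k) - u (0 + k))
      rw [zero_add]
      rw [hmod (i + k)] at hne ⊢
      exact hmin _ (Nat.mod_lt _ (by omega)) hne)
  rw [← sum_range_add_of_periodic
    (f := fun i => cross (u (i + 1) - u i) (u (i + 2) - u (i + 1))) (M := j + 2) (a := k)]
  · rw [Finset.sum_range_succ]
    simp only [e] at this ⊢
    have h0 : u (j + 1 + 2 + k) = u (1 + k) := by
      rw [← hper (1 + k)]; congr 1; omega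
    have h1 : u (j + 2 + k) = u (0 + k) := by
      rw [← hper (0 + k)]; congr 1; omega
    have e2 : j + 1 + 1 = j + 2 := rfl
    rw [e2, h0, h1]
    rw [h1] at this
    exact this
  · intro i
    have : ∀ a, u (i + (j + 2) + a) = u (i + a) := fun a => by
      rw [← hper (i + a)]; congr 1; omega
    simp only [this, hper]

/-- The rotation number theorem for simple closed grid paths: the total turning is one full turn. -/
theorem sum_cross_closed {M : ℕ} (hM : 3 ≤ M) (hcl : u M = u 0)
    (hu : ∀ i < M, IsUnitStep (u (i + 1) - u i))
    (hinj : ∀ i k, i < M → k < M → u i = u k → i = k) :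
    ∑ i ∈ Finset.range (M - 1), cross (u (i + 1) - u i) (u (i + 2) - u (i + 1)) +
        cross (u M - u (M - 1)) (u 1 - u 0) = 4 ∨
    ∑ i ∈ Finset.range (M - 1), cross (u (i + 1) - u i) (u (i + 2) - u (i + 1)) +
        cross (u M - u (M - 1)) (u 1 - u 0) = -4 := by
  have hsucc : ∀ i, u ((i + 1) % M) = u (i % M + 1) := fun i => by
    have hlt := Nat.mod_lt i (show M > 0 by omega)
    rw [Nat.add_mod, Nat.mod_eq_of_lt (show 1 < M by omega)]
    rcases Nat.lt_or_ge (i % M + 1) M with h | h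
    · rw [Nat.mod_eq_of_lt h]
    · rw [show i % M + 1 = M by omega, Nat.mod_self, hcl]
  have := sum_cross_periodic (u := fun i => u (i % M)) hM (fun i => by simp)
    (fun i => by rw [hsucc]; exact hu _ (Nat.mod_lt _ (by omega)))
    (fun i k h1 h2 h => by
      simp only [Nat.mod_eq_of_lt h1, Nat.mod_eq_of_lt h2] at h
      exact hinj i k h1 h2 h)
  obtain ⟨j, rfl⟩ : ∃ j, M = j + 1 := ⟨M - 1, by omega⟩
  rw [Finset.sum_range_succ] at this
  have hs : ∑ i ∈ Finset.range j, cross (u ((i + 1) % (j + 1)) - u (i % (j + 1)))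
      (u ((i + 2) % (j + 1)) - u ((i + 1) % (j + 1))) =
      ∑ i ∈ Finset.range j, cross (u (i + 1) - u i) (u (i + 2) - u (i + 1)) := by
    refine Finset.sum_congr rfl fun i hi => ?_
    rw [Finset.mem_range] at hi
    rw [hsucc (i + 1), Nat.mod_eq_of_lt (show i + 1 < j + 1 by omega),
      Nat.mod_eq_of_lt (show i < j + 1 by omega)]
  have e1 : (j + 2) % (j + 1) = 1 := by
    rw [show j + 2 = 1 + (j + 1) by omega, Nat.add_mod_right, Nat.mod_eq_of_lt (by omega)]
  rw [hs] at this
  simp only [e1, Nat.mod_self, Nat.mod_eq_of_lt (Nat.lt_succ_self j)] at this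
  rw [hcl]
  exact this

end Path

/-! ### Turning of grid paths and contacts with the axis -/

/-- The total turning of a grid path up to its step number `t`. -/
def turning (u : ℕ → ℤ × ℤ) (t : ℕ) : ℤ :=
  ∑ i ∈ Finset.range t, cross (u (i + 1) - u i) (u (i + 2) - u (i + 1))

theorem turning_succ (u : ℕ → ℤ × ℤ) (t : ℕ) :
    turning u (t + 1) = turning u t + cross (u (t + 1) - u t) (u (t + 2) - u (t + 1)) :=
  Finset.sum_range_succ _ _

theorem turning_add (u : ℕ → ℤ × ℤ) (s m : ℕ) :
    turning u (s + m) = turning u s + turning (fun i => u (s + i)) m :=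
  Finset.sum_range_add _ _ _

/-- A simple path of `T` unit steps in the grid that starts at the origin, heading east. -/
structure IsGridPath (u : ℕ → ℤ × ℤ) (T : ℕ) : Prop where
  start : u 0 = (0, 0)
  east : u 1 = (1, 0)
  step : ∀ i < T, IsUnitStep (u (i + 1) - u i)
  inj : ∀ i k, i ≤ T → k ≤ T → u i = u k → i = k

/-- The point `(x, 0)` lies on a vertical step of the path. -/
def OnVertical (u : ℕ → ℤ × ℤ) (T : ℕ) (x : ℤ) : Prop :=
  ∃ t < T, (u (t + 1)).1 = (u t).1 ∧ (u t = (x, 0) ∨ u (t + 1) = (x, 0))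

open Classical in
/-- The number of points `(y, 0)` with `0 ≤ y < x` on vertical steps of the path. -/
noncomputable def verticalCount (u : ℕ → ℤ × ℤ) (T : ℕ) (x : ℤ) : ℤ :=
  ((Finset.Ico 0 x).filter (OnVertical u T)).card

open Classical in
theorem verticalCount_mono {u : ℕ → ℤ × ℤ} {T : ℕ} {x y : ℤ} (h : x ≤ y) :
    verticalCount u T x ≤ verticalCount u T y := by
  unfold verticalCount
  exact_mod_cast Finset.card_le_card (Finset.filter_subset_filter _
    (Finset.Ico_subset_Ico le_rfl h))

open Classical in
theorem verticalCount_lt {u : ℕ → ℤ × ℤ} {T : ℕ} {x y : ℤ} (hx : 0 ≤ x) (h : x < y)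
    (hv : OnVertical u T x) : verticalCount u T x + 1 ≤ verticalCount u T y := by
  unfold verticalCount
  have : (Finset.Ico 0 x).filter (OnVertical u T) ⊂ (Finset.Ico 0 y).filter (OnVertical u T) := by
    refine Finset.ssubset_iff_of_subset (Finset.filter_subset_filter _
      (Finset.Ico_subset_Ico le_rfl h.le)) |>.2 ⟨x, ?_, ?_⟩
    · simp [hx, h, hv]
    · simp
  exact_mod_cast Finset.card_lt_card this

theorem verticalCount_nonneg (u : ℕ → ℤ × ℤ) (T : ℕ) (x : ℤ) : 0 ≤ verticalCount u T x :=
  Int.natCast_nonneg _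

/-- The turning of an arc that leaves the axis at `(x, 0)`, reaches it again at `(x', 0)`, and avoids
the segment between these points, through the closed path completed by this segment. -/
theorem turning_arc {u : ℕ → ℤ × ℤ} {m : ℕ} {x x' : ℤ} (hm : 1 ≤ m) (hx : x < x')
    (h0 : u 0 = (x, 0)) (h1 : u (m + 1) = (x', 0))
    (hu : ∀ i ≤ m, IsUnitStep (u (i + 1) - u i))
    (hinj : ∀ i k, i ≤ m + 1 → k ≤ m + 1 → u i = u k → i = k)
    (hav : ∀ i z, 0 < i → i ≤ m → u i = (z, 0) → x ≤ z → z ≤ x' → False) :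
    turning u m + cross (u (m + 1) - u m) (-1, 0) + cross (-1, 0) (u 1 - u 0) = 4 ∨
    turning u m + cross (u (m + 1) - u m) (-1, 0) + cross (-1, 0) (u 1 - u 0) = -4 := by
  -- The closing segment consists of `w + 1` steps west.
  obtain ⟨w, hw⟩ : ∃ w : ℕ, x' = x + w + 1 := ⟨(x' - x - 1).toNat, by omega⟩
  set c : ℕ → ℤ × ℤ := fun i => if i ≤ m + 1 then u i else (x' - (i - (m + 1) : ℤ), 0) with hc
  have c1 : ∀ i, i ≤ m + 1 → c i = u i := fun i hi => if_pos hi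
  have c2 : ∀ i, m + 1 ≤ i → c i = (x' - (i - (m + 1) : ℤ), 0) := fun i hi => by
    rcases hi.eq_or_lt with rfl | hi
    · rw [c1 _ le_rfl, h1]; simp
    · exact if_neg (by omega)
  have c3 : ∀ i, m + 1 ≤ i → c (i + 1) - c i = (-1, 0) := fun i hi => by
    rw [c2 i hi, c2 (i + 1) (by omega)]
    ext <;> simp
  have hmix : ∀ i k, i ≤ m + 1 → m + 1 < k → k < m + 1 + w + 1 → c i ≠ c k := by
    intro i k hi hk hk' h
    rw [c1 i hi, c2 k hk.le] at h
    rcases Nat.eq_zero_or_pos i with rfl | h0'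
    · rw [h0] at h
      have := congrArg Prod.fst h
      simp only at this
      omega
    · rcases hi.eq_or_lt with rfl | hi
      · rw [h1] at h
        have := congrArg Prod.fst h
        simp only at this
        omega
      · exact hav i _ h0' (by omega) h (by omega) (by omega)
  have key := sum_cross_closed (u := c) (M := m + 1 + w + 1) (by omega)
    (by rw [c2 _ (by omega), c1 0 (by omega), h0]; ext <;> simp; omega)
    (fun i hi => by
      rcases Nat.lt_or_ge i (m + 1) with h | h
      · rw [c1 i h.le, c1 (i + 1) h]; exact hu i (by omega)
      · rw [c3 i h]; simp [IsUnitStep])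
    (fun i k hi hk h => by
      rcases Nat.lt_or_ge (m + 1) i with h' | h' <;> rcases Nat.lt_or_ge (m + 1) k with h'' | h''
      · rw [c2 i h'.le, c2 k h''.le] at h
        have := congrArg Prod.fst h
        simp only at this
        omega
      · exact absurd h.symm (hmix k i h'' h' hi)
      · exact absurd h (hmix i k h' h'' hk)
      · rw [c1 i h', c1 k h''] at h; exact hinj i k h' h'' h)
  have hsum : ∑ i ∈ Finset.range (m + 1 + w + 1 - 1), cross (c (i + 1) - c i)
      (c (i + 2) - c (i + 1)) = turning u m + cross (u (m + 1) - u m) (-1, 0) := by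
    rw [Nat.add_sub_cancel, Finset.sum_range_add, Finset.sum_range_succ]
    have z : ∑ i ∈ Finset.range w, cross (c (m + 1 + i + 1) - c (m + 1 + i))
        (c (m + 1 + i + 2) - c (m + 1 + i + 1)) = 0 := by
      refine Finset.sum_eq_zero fun i _ => ?_
      rw [c3 (m + 1 + i) (by omega), c3 (m + 1 + i + 1) (by omega)]
      simp [cross]
    rw [z, add_zero, c3 (m + 1) le_rfl, c1 (m + 1) le_rfl, c1 m (by omega)]
    congr 1
    refine Finset.sum_congr rfl fun i hi => ?_
    rw [Finset.mem_range] at hi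
    rw [c1 i (by omega), c1 (i + 1) (by omega), c1 (i + 2) (by omega)]
  rw [hsum, Nat.add_sub_cancel, c3 (m + 1 + w) (by omega), c1 1 (by omega), c1 0 (by omega)] at key
  exact key

/-! ### Successive visits to the axis -/

namespace IsGridPath

variable {u : ℕ → ℤ × ℤ} {T : ℕ}

/-- Opposite steps also have cross product zero; injectivity of the path rules out such a reversal.
-/
theorem direction (h : IsGridPath u T) {t : ℕ} (ht : t < T) :
    (turning u t % 4 = 0 ∧ u (t + 1) - u t = (1, 0)) ∨
    (turning u t % 4 = 1 ∧ u (t + 1) - u t = (0, 1)) ∨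
    (turning u t % 4 = 2 ∧ u (t + 1) - u t = (-1, 0)) ∨
    (turning u t % 4 = 3 ∧ u (t + 1) - u t = (0, -1)) := by
  induction t with
  | zero => left; simp [turning, h.start, h.east]
  | succ t ih =>
    have hne : (u (t + 1) - u t) + (u (t + 1 + 1) - u (t + 1)) ≠ 0 := fun h0 => by
      have := h.inj (t + 2) t (by omega) (by omega) (by
        rw [← sub_eq_zero, ← h0]; abel)
      omega
    have hs := h.step (t + 1) ht
    rw [turning_succ]
    change IsUnitStep (u (t + 2) - u (t + 1)) at hs
    change _ + (u (t + 2) - u (t + 1)) ≠ 0 at hne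
    change _ ∧ (u (t + 2) - u (t + 1)) = _ ∨ _ ∧ (u (t + 2) - u (t + 1)) = _ ∨
      _ ∧ (u (t + 2) - u (t + 1)) = _ ∨ _ ∧ (u (t + 2) - u (t + 1)) = _
    rcases ih (by omega) with ⟨h1, h2⟩ | ⟨h1, h2⟩ | ⟨h1, h2⟩ | ⟨h1, h2⟩ <;> rw [h2] at hne ⊢ <;>
      rcases hs with h3 | h3 | h3 | h3 <;> rw [h3] at hne ⊢ <;> simp [cross] at hne ⊢ <;> omega

theorem exists_last_visit (h : IsGridPath u T) {t : ℕ} {x : ℤ} (hut : u t = (x, 0)) (hx : 0 < x) :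
    ∃ s y, s < t ∧ u s = (y, 0) ∧ 0 ≤ y ∧ y < x ∧
      ∀ i z, s < i → i < t → u i = (z, 0) → 0 ≤ z → z < x → False := by
  classical
  have ht : 0 < t := Nat.pos_of_ne_zero fun h0 => by
    rw [h0, h.start, Prod.mk.injEq] at hut; omega
  set P : ℕ → Prop := fun s => ∃ y, u s = (y, 0) ∧ 0 ≤ y ∧ y < x
  have hP0 : P 0 := ⟨0, h.start, le_rfl, hx⟩
  obtain ⟨y, h1, h2, h3⟩ : P (Nat.findGreatest P (t - 1)) :=
    Nat.findGreatest_spec (Nat.zero_le _) hP0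
  refine ⟨_, y, ?_, h1, h2, h3, fun i z hi hit hz h4 h5 => ?_⟩
  · have := Nat.findGreatest_le (P := P) (t - 1)
    omega
  · exact Nat.findGreatest_is_greatest hi (by omega) ⟨z, hz, h4, h5⟩

/-- Two consecutive visits of the axis, the first of them the last one to the left of the second. -/
theorem turning_between_visits (h : IsGridPath u T) {s t : ℕ} {x y : ℤ} (ht : t + 1 ≤ T)
    (hst : s < t + 1) (hus : u s = (y, 0)) (hut : u (t + 1) = (x, 0)) (hy : 0 ≤ y) (hyx : y < x)
    (hlast : ∀ i z, s < i → i < t + 1 → u i = (z, 0) → 0 ≤ z → z < x → False) :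
    (t = s ∧ u (s + 1) - u s = (1, 0)) ∨
    ((u (s + 1) - u s = (0, 1) ∨ u (s + 1) - u s = (0, -1)) ∧ u (t + 1) - u t ≠ (1, 0) ∧
      (turning u t - turning u s + cross (u (t + 1) - u t) (-1, 0) +
          cross (-1, 0) (u (s + 1) - u s) = 4 ∨
        turning u t - turning u s + cross (u (t + 1) - u t) (-1, 0) +
          cross (-1, 0) (u (s + 1) - u s) = -4)) := by
  have hav : ∀ i z, s < i → i < t + 1 → u i = (z, 0) → 0 ≤ z → z ≤ x → False := by
    intro i z h1 h2 h3 h4 h5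
    rcases h5.eq_or_lt with rfl | h5
    · have := h.inj i (t + 1) (by omega) ht (by rw [h3, hut])
      omega
    · exact hlast i z h1 h2 h3 h4 h5
  have hstep : ∀ e, u (s + 1) - u s = e → u (s + 1) = (y + e.1, e.2) := fun e he => by
    rw [← sub_add_cancel (u (s + 1)) (u s), he, hus]; ext <;> simp [add_comm]
  by_cases hts : t = s
  · subst hts
    left
    refine ⟨rfl, ?_⟩
    have hs := h.step t (by omega)
    rw [hut, hus] at hs ⊢
    simp only [IsUnitStep, Prod.mk_sub_mk, Prod.mk.injEq] at hs ⊢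
    omega
  · right
    have hver : u (s + 1) - u s = (0, 1) ∨ u (s + 1) - u s = (0, -1) := by
      rcases h.step s (by omega) with h1 | h1 | h1 | h1
      · exact (hav (s + 1) (y + 1) (by omega) (by omega) (hstep _ h1) (by omega) (by omega)).elim
      · exact Or.inl h1
      -- A step west from `y > 0` lands in the forbidden interval; `y = 0` occurs only at time 0,
      -- when the step is east.
      · rcases hy.eq_or_lt with rfl | hy
        · have := h.inj s 0 (by omega) (by omega) (by rw [hus, h.start])
          subst this
          rw [h.start, zero_add, h.east] at h1
          simp at h1
        · exact (hav (s + 1) (y + -1) (by omega) (by omega) (hstep _ h1) (by omega)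
            (by omega)).elim
      · exact Or.inr h1
    refine ⟨hver, fun h1 => ?_, ?_⟩
    · have : u t = (x - 1, 0) := by
        rw [← sub_sub_cancel (u (t + 1)) (u t), h1, hut]; ext <;> simp
      exact hav t (x - 1) (by omega) (by omega) this (by omega) (by omega)
    · obtain ⟨m, rfl⟩ : ∃ m, t = s + m := ⟨t - s, by omega⟩
      have := turning_arc (u := fun i => u (s + i)) (m := m) (by omega) hyx hus hut
        (fun i hi => h.step (s + i) (by omega))
        (fun i k hi hk hik => by
          have := h.inj _ _ (by omega) (by omega) hik
          omega)
        (fun i z h1 h2 h3 h4 h5 => hav (s + i) z (by omega) (by omega) h3 (by omega) h5)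
      rw [turning_add, add_sub_cancel_left]
      exact this

theorem onVertical_of_step {s : ℕ} {y : ℤ} (hs : s < T) (hus : u s = (y, 0) ∨ u (s + 1) = (y, 0))
    (hver : u (s + 1) - u s = (0, 1) ∨ u (s + 1) - u s = (0, -1)) : OnVertical u T y := by
  refine ⟨s, hs, ?_, hus⟩
  rw [← sub_eq_zero, ← Prod.fst_sub]
  rcases hver with h | h <;> rw [h]

theorem turning_bounds (h : IsGridPath u T) {t : ℕ} (ht : t + 1 < T) :
    turning u (t + 1) ≤ turning u t + 1 ∧ turning u t - 1 ≤ turning u (t + 1) := by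
  rw [turning_succ]
  have h2 := h.step (t + 1) ht
  change IsUnitStep (u (t + 2) - u (t + 1)) at h2
  rcases h.step t (by omega) with h1 | h1 | h1 | h1 <;> rcases h2 with h2 | h2 | h2 | h2 <;>
    rw [h1, h2] <;> simp [cross] <;> omega

/-- Each visit to the positive axis after the first bend, which happens at time `b`, has turning
controlled by the number of vertical steps touching the axis further to the left. -/
theorem turning_le (h : IsGridPath u T) {b : ℕ} (hb : b < T) {c : ℤ} (hc : c % 4 = 3)
    (hbefore : ∀ t < b, u (t + 1) - u t = (1, 0))
    (hbend : u (b + 1) - u b = (0, 1) ∨ u (b + 1) - u b = (0, -1)) (hbc : turning u b ≤ c)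
    (t : ℕ) (hbt : b ≤ t) (ht : t + 1 ≤ T) (x : ℤ) (hut : u (t + 1) = (x, 0)) (hx : 0 < x) :
    turning u t ≤ 4 * verticalCount u T x + c := by
  induction t using Nat.strong_induction_on generalizing x with
  | _ t ih =>
  obtain ⟨s, y, hst, hus, hy, hyx, hlast⟩ := h.exists_last_visit hut hx
  -- Before the bend every step is east, so a visit `s < b` would be followed at once by the visit
  -- `t + 1`, against `b ≤ t`.
  have hbs : b ≤ s := by
    by_contra! hlt
    rcases h.turning_between_visits ht hst hus hut hy hyx hlast with ⟨h1, -⟩ | ⟨h1, -⟩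
    · omega
    · rw [hbefore s hlt] at h1
      simp at h1
  have hmono := verticalCount_mono (u := u) (T := T) hyx.le
  have hpos := verticalCount_nonneg u T y
  have hlt := verticalCount_lt (u := u) (T := T) hy hyx
  have hprev : s = b ∨ ∃ q, s = q + 1 ∧ turning u q ≤ 4 * verticalCount u T y + c := by
    rcases hbs.eq_or_lt with rfl | hbs
    · exact Or.inl rfl
    · right
      refine ⟨s - 1, by omega, ?_⟩
      have hs1 : s - 1 + 1 = s := by omega
      refine ih (s - 1) (by omega) (by omega) (by omega) y (by rw [hs1, hus]) ?_
      refine lt_of_le_of_ne hy fun h0 => ?_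
      have := h.inj s 0 (by omega) (by omega) (by rw [hus, h.start, h0])
      omega
  have hdt := h.direction (t := t) (by omega)
  have hds := h.direction (t := s) (by omega)
  rcases h.turning_between_visits ht hst hus hut hy hyx hlast with ⟨rfl, h1⟩ | ⟨hver, hne, harc⟩
  · rcases hprev with rfl | ⟨q, rfl, hq⟩
    · rw [h1] at hbend
      simp at hbend
    · have hdq := h.direction (t := q) (by omega)
      have hbd := h.turning_bounds (t := q) (by omega)
      -- The turning changes before a step east only if the step into `(y, 0)` was vertical, and
      -- then `y` is a new contact.
      have hv : turning u q % 4 = 1 ∨ turning u q % 4 = 3 → OnVertical u T y := fun hq4 =>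
        onVertical_of_step (s := q) (by omega) (Or.inr hus) (by
          rcases hdq with hd | hd | hd | hd
          · omega
          · exact Or.inl hd.2
          · omega
          · exact Or.inr hd.2)
      simp only [h1, Prod.mk.injEq] at hds
      have hq4 : turning u q % 4 = 0 ∨ turning u q % 4 = 1 ∨ turning u q % 4 = 3 ∨
        turning u q % 4 = 2 := by omega
      rcases hq4 with h4 | h4 | h4 | h4
      · omega
      · have := hlt (hv (Or.inl h4)); omega
      · have := hlt (hv (Or.inr h4)); omega
      · omega
  · have hcount := hlt (onVertical_of_step (by omega) (Or.inl hus) hver)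
    -- If the bound is attained at `q`, that step heads south because `c % 4 = 3`; the next step,
    -- being vertical, continues south with the same turning.
    have hs : turning u s ≤ 4 * verticalCount u T y + c := by
      rcases hprev with rfl | ⟨q, rfl, hq⟩
      · omega
      · have hbd := h.turning_bounds (t := q) (by omega)
        rcases hver with h1 | h1 <;> simp only [h1, Prod.mk.injEq] at hds <;> omega
    -- An arc leaving south gains at most 4. One leaving north may gain 6, but there the turning is
    -- 1 modulo 4, so the bound at `s` has 2 to spare.
    rcases hver with h1 | h1 <;> simp only [h1, Prod.mk.injEq] at hds harc <;>
      rcases hdt with ⟨h2, h3⟩ | ⟨h2, h3⟩ | ⟨h2, h3⟩ | ⟨h2, h3⟩ <;>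
      first
      | exact absurd h3 hne
      | (simp [h3, cross] at harc; omega)

theorem eq_of_before_bend (h : IsGridPath u T) {b : ℕ}
    (hbefore : ∀ t < b, u (t + 1) - u t = (1, 0)) {t : ℕ} (ht : t ≤ b) : u t = ((t : ℤ), 0) := by
  induction t with
  | zero => simpa using h.start
  | succ t ih =>
    rw [← sub_add_cancel (u (t + 1)) (u t), hbefore t (by omega), ih (by omega)]
    ext <;> simp [add_comm]

/-- The last arc leaves the axis vertically. The second contact is the endpoint if the last step is
vertical, and the first bend if it heads west. -/
theorem exists_two_onVertical (h : IsGridPath u T) {b t : ℕ} (hT : t + 1 = T) (hb : b < T)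
    (hbefore : ∀ t < b, u (t + 1) - u t = (1, 0))
    (hbend : u (b + 1) - u b = (0, 1)) (hbc : turning u b = 1)
    {x : ℤ} (hut : u (t + 1) = (x, 0)) (hx : 0 < x)
    (h1 : 1 ≤ turning u t) (h3 : turning u t ≤ 3) :
    ∃ y z, y ≠ z ∧ 0 ≤ y ∧ y ≤ x ∧ 0 ≤ z ∧ z ≤ x ∧ OnVertical u T y ∧ OnVertical u T z := by
  obtain ⟨s, y, hst, hus, hy, hyx, hlast⟩ := h.exists_last_visit hut hx
  have hdt := h.direction (t := t) (by omega)
  rcases h.turning_between_visits hT.le hst hus hut hy hyx hlast with ⟨rfl, h4⟩ | ⟨hver, hne, harc⟩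
  · simp only [h4, Prod.mk.injEq] at hdt
    omega
  · have hvy : OnVertical u T y := onVertical_of_step (by omega) (Or.inl hus) hver
    have hbv : OnVertical u T b := onVertical_of_step hb
      (Or.inl (h.eq_of_before_bend hbefore le_rfl)) (Or.inl hbend)
    rcases hdt with ⟨h5, h6⟩ | ⟨h5, h6⟩ | ⟨h5, h6⟩ | ⟨h5, h6⟩
    · omega
    · exact ⟨y, x, hyx.ne, hy, hyx.le, hx.le, le_rfl, hvy,
        onVertical_of_step (s := t) (by omega) (Or.inr hut) (Or.inl h6)⟩
    -- If `y = b`, the closed path would have total turning `2 - 1 - 1 = 0`. If `x < b`, the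
    -- endpoint would lie on the first segment.
    · refine ⟨y, b, fun hyb => ?_, hy, hyx.le, by omega, ?_, hvy, hbv⟩
      · have : s = b := h.inj s b (by omega) (by omega)
          (by rw [hus, h.eq_of_before_bend hbefore le_rfl, hyb])
        subst this
        rw [hbend, h6, hbc] at harc
        simp [cross] at harc
        omega
      · by_contra! hlt
        have h7 := h.eq_of_before_bend hbefore (t := x.toNat) (by omega)
        rw [Int.toNat_of_nonneg hx.le, ← hut] at h7
        have := h.inj _ _ (by omega) (by omega) h7
        omega
    · exact ⟨y, x, hyx.ne, hy, hyx.le, hx.le, le_rfl, hvy,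
        onVertical_of_step (s := t) (by omega) (Or.inr hut) (Or.inr h6)⟩

end IsGridPath

theorem floor_sub_div_four (l r : ℕ) : ⌊((l : ℚ) - (r : ℚ)) / 4⌋ = ((l : ℤ) - (r : ℤ)) / 4 := by
  have := Rat.floor_intCast_div_natCast ((l : ℤ) - (r : ℤ)) 4
  push_cast at this
  exact this

theorem toPlane_mem_segment {p q x : ℤ × ℤ} {L s : ℕ} (hL : 0 < L) (hs : s ≤ L) {e : ℤ × ℤ}
    (hq : q = p + (L : ℤ) • e) (hx : x = p + (s : ℤ) • e) :
    toPlane x ∈ segment ℝ (toPlane p) (toPlane q) := by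
  have hL' : (0 : ℝ) < L := by exact_mod_cast hL
  have hs' : (s : ℝ) ≤ L := by exact_mod_cast hs
  refine ⟨1 - s / L, s / L, ?_, by positivity, by ring, ?_⟩
  · rw [sub_nonneg, div_le_one hL']; exact hs'
  · subst hq hx
    ext <;> simp [toPlane] <;> field_simp <;> ring

theorem cross_sign {d e : ℤ × ℤ} (hd : d.2 = 0 ∨ d.1 = 0) (he : e.2 = 0 ∨ e.1 = 0) :
    cross (d.1.sign, d.2.sign) (e.1.sign, e.2.sign) = (cross d e).sign := by
  simp only [cross, ← Int.sign_mul]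
  rcases hd with h1 | h1 <;> rcases he with h2 | h2 <;> simp [h1, h2]

theorem sum_turn_eq {n : ℕ} (σ : Fin n → Turn) :
    ∑ i, (if σ i = Turn.L then (1 : ℤ) else -1) = turnCount σ Turn.L - turnCount σ Turn.R := by
  have h : ∀ i, (if σ i = Turn.L then (1 : ℤ) else -1) =
      (if σ i = Turn.L then 1 else 0) - (if σ i = Turn.R then 1 else 0) := fun i => by
    cases σ i <;> simp
  simp only [h, Finset.sum_sub_distrib, turnCount, Finset.sum_boole]

/-! ### From chains to paths of unit steps -/

namespace RectChain

variable {n : ℕ} (C : RectChain n)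

/-- The vertices of the chain, indexed by natural numbers (constant after the last vertex). -/
def vtx (i : ℕ) : ℤ × ℤ := C.vertex ⟨min i (n + 1), by omega⟩

/-- The length of the `i`-th segment. -/
def segLength (i : ℕ) : ℕ :=
  (C.vtx (i + 1) - C.vtx i).1.natAbs + (C.vtx (i + 1) - C.vtx i).2.natAbs

/-- The unit vector in the direction of the `i`-th segment. -/
def unitDir (i : ℕ) : ℤ × ℤ :=
  ((C.vtx (i + 1) - C.vtx i).1.sign, (C.vtx (i + 1) - C.vtx i).2.sign)

/-- The distance from the start to the `i`-th vertex, measured along the chain. -/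
def arrival (i : ℕ) : ℕ := ∑ j ∈ Finset.range i, C.segLength j

/-- The grid points on the chain, in order. -/
def gridPath (t : ℕ) : ℤ × ℤ :=
  C.vtx (Nat.findGreatest (fun i => C.arrival i ≤ t) n) +
    ((t - C.arrival (Nat.findGreatest (fun i => C.arrival i ≤ t) n) : ℕ) : ℤ) •
      C.unitDir (Nat.findGreatest (fun i => C.arrival i ≤ t) n)

theorem vertex_castSucc (i : Fin (n + 1)) : C.vertex i.castSucc = C.vtx i := by
  unfold vtx
  congr 1
  ext
  simp

theorem vertex_succ (i : Fin (n + 1)) : C.vertex i.succ = C.vtx (i + 1) := by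
  unfold vtx
  congr 1
  ext
  simp
  omega

theorem dir_eq (i : Fin (n + 1)) : C.dir i = C.vtx (i + 1) - C.vtx i := by
  rw [dir, vertex_succ, vertex_castSucc]

theorem vtx_axisParallel {i : ℕ} (hi : i ≤ n) :
    (C.vtx (i + 1) - C.vtx i).2 = 0 ∨ (C.vtx (i + 1) - C.vtx i).1 = 0 := by
  have := C.axisParallel ⟨i, by omega⟩
  rw [vertex_castSucc, vertex_succ] at this
  simp only [Prod.fst_sub, Prod.snd_sub] at this ⊢
  omega

theorem vtx_ne {i : ℕ} (hi : i ≤ n) : C.vtx i ≠ C.vtx (i + 1) := by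
  have := C.nondegenerate ⟨i, by omega⟩
  rwa [vertex_castSucc, vertex_succ] at this

theorem segLength_pos {i : ℕ} (hi : i ≤ n) : 0 < C.segLength i := by
  have h := C.vtx_ne hi
  rw [Ne, Prod.ext_iff] at h
  simp only [segLength, Prod.fst_sub, Prod.snd_sub]
  omega

theorem vtx_succ {i : ℕ} (hi : i ≤ n) :
    C.vtx (i + 1) = C.vtx i + (C.segLength i : ℤ) • C.unitDir i := by
  have h := C.vtx_axisParallel hi
  rw [← sub_eq_iff_eq_add']
  simp only [segLength, unitDir]
  generalize C.vtx (i + 1) - C.vtx i = d at *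
  obtain ⟨x, y⟩ := d
  simp only at h
  rcases h with rfl | rfl
  · ext
    · simp only [Prod.smul_fst, smul_eq_mul, Int.natAbs_zero, add_zero]
      rw [mul_comm, Int.sign_mul_natAbs]
    · simp
  · ext
    · simp
    · simp only [Prod.smul_snd, smul_eq_mul, Int.natAbs_zero, zero_add]
      rw [mul_comm, Int.sign_mul_natAbs]

theorem unitDir_isUnitStep {i : ℕ} (hi : i ≤ n) : IsUnitStep (C.unitDir i) := by
  have h := C.vtx_axisParallel hi
  have h2 := C.vtx_ne hi
  rw [← sub_ne_zero, ← neg_sub, neg_ne_zero] at h2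
  simp only [unitDir]
  generalize C.vtx (i + 1) - C.vtx i = d at *
  obtain ⟨x, y⟩ := d
  simp only at h
  rcases h with rfl | rfl
  · rcases lt_trichotomy x 0 with hx | rfl | hx
    · simp [IsUnitStep, Int.sign_eq_neg_one_of_neg hx]
    · simp at h2
    · simp [IsUnitStep, Int.sign_eq_one_of_pos hx]
  · rcases lt_trichotomy y 0 with hx | rfl | hx
    · simp [IsUnitStep, Int.sign_eq_neg_one_of_neg hx]
    · simp at h2
    · simp [IsUnitStep, Int.sign_eq_one_of_pos hx]

theorem arrival_succ (i : ℕ) : C.arrival (i + 1) = C.arrival i + C.segLength i :=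
  Finset.sum_range_succ _ _

theorem arrival_mono {i j : ℕ} (h : i ≤ j) : C.arrival i ≤ C.arrival j :=
  Finset.sum_le_sum_of_subset (Finset.range_subset_range.2 h)

theorem gridPath_of_lt {i s : ℕ} (hi : i ≤ n) (hs : s < C.segLength i) :
    C.gridPath (C.arrival i + s) = C.vtx i + (s : ℤ) • C.unitDir i := by
  have : Nat.findGreatest (fun k => C.arrival k ≤ C.arrival i + s) n = i := by
    rw [Nat.findGreatest_eq_iff]
    refine ⟨hi, fun _ => Nat.le_add_right _ _, fun k hk _ => ?_⟩
    have := C.arrival_mono hk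
    rw [arrival_succ] at this
    omega
  rw [gridPath, this, Nat.add_sub_cancel_left]

/-- At the far end of a segment the formula of the next segment gives the same vertex; on the last
segment the search, bounded by `n`, stays there. -/
theorem gridPath_eq {i s : ℕ} (hi : i ≤ n) (hs : s ≤ C.segLength i) :
    C.gridPath (C.arrival i + s) = C.vtx i + (s : ℤ) • C.unitDir i := by
  rcases hs.lt_or_eq with hs | rfl
  · exact C.gridPath_of_lt hi hs
  · rcases hi.lt_or_eq with hi' | rfl
    · have := C.gridPath_of_lt (i := i + 1) (s := 0) hi' (C.segLength_pos hi')
      rw [arrival_succ] at this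
      rw [← C.vtx_succ hi]
      simpa using this
    · have : Nat.findGreatest (fun k => C.arrival k ≤ C.arrival i + C.segLength i) i = i := by
        rw [Nat.findGreatest_eq_iff]
        exact ⟨le_rfl, fun _ => Nat.le_add_right _ _, fun k hk hk' => by omega⟩
      rw [gridPath, this, Nat.add_sub_cancel_left]

theorem gridPath_step {i s : ℕ} (hi : i ≤ n) (hs : s < C.segLength i) :
    C.gridPath (C.arrival i + s + 1) - C.gridPath (C.arrival i + s) = C.unitDir i := by
  rw [add_assoc, C.gridPath_eq hi hs, C.gridPath_eq hi hs.le]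
  push_cast
  rw [add_smul, one_smul]
  abel

theorem exists_location {t m : ℕ} (ht : t < C.arrival m) :
    ∃ i < m, ∃ s < C.segLength i, t = C.arrival i + s := by
  induction m with
  | zero => simp [arrival] at ht
  | succ m ih =>
    rcases Nat.lt_or_ge t (C.arrival m) with h | h
    · obtain ⟨i, hi, h⟩ := ih h
      exact ⟨i, by omega, h⟩
    · rw [arrival_succ] at ht
      exact ⟨m, by omega, t - C.arrival m, by omega, by omega⟩

theorem toPlane_mem_seg {i s : ℕ} (hi : i ≤ n) (hs : s ≤ C.segLength i) {x : ℤ × ℤ}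
    (hx : x = C.vtx i + (s : ℤ) • C.unitDir i) :
    toPlane x ∈ C.seg ⟨i, by omega⟩ := by
  rw [seg, vertex_castSucc, vertex_succ]
  exact toPlane_mem_segment (C.segLength_pos hi) hs (C.vtx_succ hi) hx

theorem smul_unitDir_injective {i : ℕ} (hi : i ≤ n) {s s' : ℤ}
    (h : s • C.unitDir i = s' • C.unitDir i) : s = s' := by
  rcases C.unitDir_isUnitStep hi with e | e | e | e <;> rw [e] at h <;> simpa using h

theorem toPlane_injective : Function.Injective toPlane := fun a b h => by
  simp only [toPlane, Prod.mk.injEq, Int.cast_inj] at h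
  exact Prod.ext h.1 h.2

theorem gridPath_ne {t t' : ℕ} (htt : t < t') (ht : t' ≤ C.arrival (n + 1)) :
    C.gridPath t ≠ C.gridPath t' := by
  obtain ⟨i, hi, s, hs, rfl⟩ := C.exists_location (lt_of_lt_of_le htt ht)
  -- Locating `t' - 1` covers the endpoint of the chain, which starts no segment.
  obtain ⟨j, hj, s', hs', ht'⟩ := C.exists_location (t := t' - 1) (m := n + 1) (by omega)
  obtain rfl : t' = C.arrival j + (s' + 1) := by omega
  have hi' : i ≤ n := by omega
  have hj' : j ≤ n := by omega
  rw [C.gridPath_eq hi' hs.le, C.gridPath_eq hj' hs']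
  intro h
  rcases lt_trichotomy i j with hij | rfl | hij
  · obtain ⟨h1, h2⟩ := C.simple ⟨i, hi⟩ ⟨j, hj⟩ hij _ (C.toPlane_mem_seg hi' hs.le rfl)
      (C.toPlane_mem_seg hj' hs' h)
    have h3 : i + 1 = j := by simpa [Fin.ext_iff] using h1
    subst h3
    rw [vertex_castSucc] at h2
    have h4 := toPlane_injective h2
    change _ = C.vtx (i + 1) at h4
    rw [C.vtx_succ hi'] at h4
    have := C.smul_unitDir_injective hi' (add_left_cancel h4)
    omega
  · have := C.smul_unitDir_injective hi' (add_left_cancel h)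
    omega
  · have := C.arrival_mono (i := j + 1) (j := i) hij
    rw [arrival_succ] at this
    omega

/-- Consecutive steps within one segment are parallel, so only bends contribute. -/
theorem turning_gridPath {i s : ℕ} (hi : i ≤ n) (hs : s < C.segLength i) :
    turning C.gridPath (C.arrival i + s) =
      ∑ j ∈ Finset.range i, cross (C.unitDir j) (C.unitDir (j + 1)) := by
  induction i generalizing s with
  | zero =>
    induction s with
    | zero => simp [turning, arrival]
    | succ s ih =>
      have h1 := C.gridPath_step hi hs
      rw [← add_assoc, turning_succ, ih (by omega), C.gridPath_step hi (by omega)]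
      rw [← add_assoc] at h1
      rw [h1]
      simp [cross, mul_comm]
  | succ i ihi =>
    induction s with
    | zero =>
      have hpos := C.segLength_pos (i := i) (by omega)
      have h0 := ihi (s := C.segLength i - 1) (by omega) (by omega)
      have h1 := C.gridPath_step hi hs
      have h2 := C.gridPath_step (i := i) (s := C.segLength i - 1) (by omega) (by omega)
      rw [Finset.sum_range_succ, ← h0]
      have e : C.arrival (i + 1) + 0 = C.arrival i + (C.segLength i - 1) + 1 := by
        rw [arrival_succ]; omega
      rw [e] at h1 ⊢
      rw [turning_succ, h2, h1]
    | succ s ih =>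
      have h1 := C.gridPath_step hi hs
      rw [← add_assoc, turning_succ, ih (by omega), C.gridPath_step hi (by omega)]
      rw [← add_assoc] at h1
      rw [h1]
      simp [cross, mul_comm]

variable {C} {σ : Fin n → Turn}

theorem Realizes.unitDir_zero (hC : C.Realizes σ) : C.unitDir 0 = (1, 0) := by
  have h := hC.east
  rw [dir_eq] at h
  change 0 < (C.vtx 1 - C.vtx 0).1 ∧ (C.vtx 1 - C.vtx 0).2 = 0 at h
  simp only [unitDir, zero_add, h.2, Int.sign_zero, Int.sign_eq_one_of_pos h.1]

theorem Realizes.cross_unitDir (hC : C.Realizes σ) (i : Fin n) :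
    cross (C.unitDir i) (C.unitDir (i + 1)) = if σ i = Turn.L then 1 else -1 := by
  have h := hC.turns i
  rw [dir_eq, dir_eq] at h
  simp only [Fin.val_castSucc, Fin.val_succ] at h
  rw [unitDir, unitDir, cross_sign (C.vtx_axisParallel (by omega)) (C.vtx_axisParallel (by omega))]
  cases hσ : σ i <;> rw [hσ] at h
  · exact Int.sign_eq_one_of_pos h
  · exact Int.sign_eq_neg_one_of_neg h

theorem Realizes.sum_cross_unitDir (hC : C.Realizes σ) :
    ∑ j ∈ Finset.range n, cross (C.unitDir j) (C.unitDir (j + 1)) =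
      turnCount σ Turn.L - turnCount σ Turn.R := by
  rw [← sum_turn_eq, Finset.sum_range]
  exact Finset.sum_congr rfl fun i _ => hC.cross_unitDir i

theorem Realizes.gridPath_zero (hC : C.Realizes σ) : C.gridPath 0 = (0, 0) := by
  have h0 := C.gridPath_eq (i := 0) (s := 0) (by omega) (by omega)
  have : C.vtx 0 = (0, 0) := hC.start
  simpa [arrival, this] using h0

theorem Realizes.isGridPath (hC : C.Realizes σ) : IsGridPath C.gridPath (C.arrival (n + 1)) where
  start := hC.gridPath_zero
  east := by
    have h1 := C.gridPath_step (i := 0) (s := 0) (by omega) (C.segLength_pos (by omega))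
    rw [hC.unitDir_zero] at h1
    rw [sub_eq_iff_eq_add] at h1
    simpa [arrival, hC.gridPath_zero] using h1
  step t ht := by
    obtain ⟨i, hi, s, hs, rfl⟩ := C.exists_location ht
    rw [C.gridPath_step (by omega) hs]
    exact C.unitDir_isUnitStep (by omega)
  inj i k hi hk h := by
    by_contra hne
    rcases Nat.lt_or_gt_of_ne hne with h1 | h1
    · exact C.gridPath_ne h1 hk h
    · exact C.gridPath_ne h1 hi h.symm

theorem exists_verticalMeeting {x a : ℤ} (hx : 0 ≤ x) (hxa : x ≤ a)
    (hv : OnVertical C.gridPath (C.arrival (n + 1)) x) :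
    ∃ i ∈ C.verticalMeeting (a, 0), (C.vtx i).1 = x := by
  obtain ⟨t, ht, hfst, hor⟩ := hv
  obtain ⟨i, hi, s, hs, rfl⟩ := C.exists_location ht
  have hi' : i ≤ n := by omega
  have hd : (C.unitDir i).1 = 0 := by
    rw [← C.gridPath_step hi' hs, Prod.fst_sub, hfst, sub_self]
  obtain ⟨s', hs', hxs⟩ : ∃ s' ≤ C.segLength i, (x, 0) = C.vtx i + (s' : ℤ) • C.unitDir i := by
    rcases hor with h | h
    · exact ⟨s, hs.le, by rw [← h, C.gridPath_eq hi' hs.le]⟩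
    · exact ⟨s + 1, hs, by rw [← h, add_assoc, C.gridPath_eq hi' hs]⟩
  refine ⟨⟨i, hi⟩, ⟨?_, toPlane (x, 0), C.toPlane_mem_seg hi' hs' hxs, ?_⟩, ?_⟩
  · rw [IsVertical, vertex_castSucc, vertex_succ]
    change (C.vtx i).1 = (C.vtx (i + 1)).1
    rw [C.vtx_succ hi']
    simp [hd]
  · rcases hxa.eq_or_lt with rfl | hlt
    · exact right_mem_segment ..
    · exact toPlane_mem_segment (L := a.toNat) (s := x.toNat) (e := (1, 0)) (by omega) (by omega)
        (by ext <;> simp; omega) (by ext <;> simp [hx])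
  · have := congrArg Prod.fst hxs
    simpa [hd] using this.symm

open Classical in
-- A vertical segment has a single abscissa, so distinct contacts lie on distinct segments.
theorem card_onVertical_le (a : ℤ) :
    (((Finset.Icc 0 a).filter (OnVertical C.gridPath (C.arrival (n + 1)))).card : ℤ) ≤
      (C.verticalMeeting (a, 0)).ncard := by
  have hsub : (((Finset.Icc 0 a).filter (OnVertical C.gridPath (C.arrival (n + 1))) :
      Finset ℤ) : Set ℤ) ⊆ (fun i : Fin (n + 1) => (C.vtx i).1) '' C.verticalMeeting (a, 0) := by
    intro x hx
    simp only [Finset.coe_filter, Finset.mem_Icc, Set.mem_ofPred_eq] at hx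
    obtain ⟨i, hi, h⟩ := exists_verticalMeeting hx.1.1 hx.1.2 hx.2
    exact ⟨i, hi, h⟩
  have h1 := Set.ncard_le_ncard hsub (Set.toFinite _)
  have h2 := Set.ncard_image_le (f := fun i : Fin (n + 1) => (C.vtx i).1)
    (s := C.verticalMeeting (a, 0)) (Set.toFinite _)
  rw [Set.ncard_coe_finset] at h1
  exact_mod_cast h1.trans h2

theorem verticalCount_le (a : ℤ) :
    verticalCount C.gridPath (C.arrival (n + 1)) a ≤ (C.verticalMeeting (a, 0)).ncard := by
  classical
  refine le_trans ?_ (card_onVertical_le a)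
  unfold verticalCount
  exact_mod_cast Finset.card_le_card (by
    convert Finset.filter_subset_filter _ Finset.Ico_subset_Icc_self)

theorem two_le_verticalMeeting {a y z : ℤ} (hyz : y ≠ z) (hy : 0 ≤ y) (hya : y ≤ a) (hz : 0 ≤ z)
    (hza : z ≤ a) (hvy : OnVertical C.gridPath (C.arrival (n + 1)) y)
    (hvz : OnVertical C.gridPath (C.arrival (n + 1)) z) :
    2 ≤ ((C.verticalMeeting (a, 0)).ncard : ℤ) := by
  classical
  refine le_trans ?_ (card_onVertical_le a)
  have h2 := Finset.card_pair hyz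
  suffices h : ({y, z} : Finset ℤ).card ≤ _ by rw [h2] at h; exact_mod_cast h
  refine Finset.card_le_card fun x hx => ?_
  rw [Finset.mem_insert, Finset.mem_singleton] at hx
  rcases hx with rfl | rfl <;> simp [*]

end RectChain

/-! ### The two lower bounds -/

theorem theorem5 {n : ℕ} (hn : 0 < n) (σ : Fin n → Turn) (l r : ℕ)
    (hl : turnCount σ Turn.L = l) (hr : turnCount σ Turn.R = r)
    (hlr : r ≤ l) (hmod : ¬ ((l : ℤ) - (r : ℤ) ≡ 0 [ZMOD 4]))
    (C : RectChain n) (hC : C.Realizes σ)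
    (p : ℤ × ℤ) (hp : C.endpoint = p) (hpx : 0 < p.1 ∧ p.2 = 0) :
    (σ ⟨0, hn⟩ = Turn.L →
      |⌊((l : ℚ) - (r : ℚ)) / 4⌋ - 1| + 1 ≤ ((C.verticalMeeting p).ncard : ℤ)) ∧
    (σ ⟨0, hn⟩ = Turn.R →
      ⌊((l : ℚ) - (r : ℚ)) / 4⌋ + 1 ≤ ((C.verticalMeeting p).ncard : ℤ)) := by
  obtain ⟨a, p2⟩ := p
  obtain ⟨ha, rfl⟩ : 0 < a ∧ p2 = 0 := hpx
  rw [floor_sub_div_four]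
  rw [Int.ModEq] at hmod
  have hpos := C.segLength_pos (i := n) le_rfl
  have hT := C.arrival_succ n
  have hpath := hC.isGridPath
  have hturn : turning C.gridPath (C.arrival n + (C.segLength n - 1)) = l - r := by
    rw [C.turning_gridPath le_rfl (by omega), hC.sum_cross_unitDir, hl, hr]
  have hlast : C.arrival n + (C.segLength n - 1) + 1 = C.arrival (n + 1) := by omega
  have hend : C.gridPath (C.arrival n + (C.segLength n - 1) + 1) = (a, 0) := by
    rw [hlast, hT, C.gridPath_eq le_rfl le_rfl, ← C.vtx_succ le_rfl, ← hp, RectChain.endpoint,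
      RectChain.vtx]
    congr 1
    ext
    simp
  have hb : C.arrival 1 < C.arrival (n + 1) := by
    have := C.arrival_mono (i := 1) (j := n) hn
    omega
  have hbn : C.arrival 1 ≤ C.arrival n + (C.segLength n - 1) := by omega
  have hbefore : ∀ t < C.arrival 1, C.gridPath (t + 1) - C.gridPath t = (1, 0) := fun t ht => by
    obtain ⟨i, hi, s, hs, rfl⟩ := C.exists_location ht
    obtain rfl : i = 0 := by omega
    rw [C.gridPath_step (by omega) hs, hC.unitDir_zero]
  have hstep1 := C.gridPath_step (i := 1) (s := 0) hn (C.segLength_pos hn)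
  have hturn1 := C.turning_gridPath (i := 1) (s := 0) hn (C.segLength_pos hn)
  have hcross := hC.cross_unitDir ⟨0, hn⟩
  rw [Finset.sum_range_one] at hturn1
  rw [add_zero] at hstep1 hturn1
  simp only [zero_add] at hcross hturn1
  rw [hcross] at hturn1
  rw [hC.unitDir_zero] at hcross
  have hle := C.verticalCount_le a
  constructor
  · intro hσ
    rw [if_pos hσ] at hcross hturn1
    have hdir : C.unitDir 1 = (0, 1) := by
      rcases C.unitDir_isUnitStep (i := 1) hn with h | h | h | h <;> rw [h] at hcross <;>
        simp [cross] at hcross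
      exact h
    rw [hdir] at hstep1
    -- The turning after the first bend is 1, and 3 is the least admissible constant above it.
    have hmain := hpath.turning_le hb (c := 3) (by norm_num) hbefore (Or.inl hstep1)
      (by omega) _ hbn (by omega) a hend ha
    rw [hturn] at hmain
    -- With quotient 0 the turning is 1, 2 or 3, and two contacts are required.
    rcases Int.lt_or_le (((l : ℤ) - r) / 4) 1 with hm | hm
    · obtain ⟨y, z, hyz, hy, hya, hz, hza, hvy, hvz⟩ := hpath.exists_two_onVertical hlast hb hbefore
        hstep1 hturn1 hend ha (by omega) (by omega)
      have := RectChain.two_le_verticalMeeting hyz hy hya hz hza hvy hvz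
      rw [abs_of_nonpos (by omega)]
      omega
    · rw [abs_of_nonneg (by omega)]
      omega
  · intro hσ
    rw [if_neg (by rw [hσ]; decide)] at hcross hturn1
    have hdir : C.unitDir 1 = (0, -1) := by
      rcases C.unitDir_isUnitStep (i := 1) hn with h | h | h | h <;> rw [h] at hcross <;>
        simp [cross] at hcross
      exact h
    rw [hdir] at hstep1
    -- The turning after the first bend is -1, itself 3 modulo 4; the smaller constant accounts for
    -- the additional contact.
    have hmain := hpath.turning_le hb (c := -1) (by norm_num) hbefore (Or.inr hstep1)
      (by omega) _ hbn (by omega) a hend ha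
    rw [hturn] at hmain
    omega
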